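/- All maps are of class $C^\infty$. Let $I\subset\mathbb R$ be an open interval, $t_0\in I$, and let $(\gamma,\nu):I\to\mathbb R^2\times S^1$, $\gamma=(x,z)$, $\nu=(a,b)$, be a Legendre curve, i.e. $\dot\gamma\cdot\nu=0$ on $I$. Put $\mu=(-b,a)$, and let $(\ell,\beta)=(\dot\nu\cdot\mu,\ \dot\gamma\cdot\mu)$ be its curvature. The surface of revolution of $\gamma$ around the $z$-axis is $$X(t,\theta)=(x(t)\cos\theta,\ x(t)\sin\theta,\ z(t)),\qquad \theta\in[0,2\pi),$$ framed by $n=(a\cos\theta,a\sin\theta,b)$, $s=(\sin\theta,-\cos\theta,0)$ and $\tau=n\times s$. Write $X_t=a_1s+b_1\tau$, $X_\theta=a_2s+b_2\tau$, $n_t=e_1s+f_1\tau$, $n_\theta=e_2s+f_2\tau$, and put $$J=\det\begin{pmatrix}a_1&b_1\\a_2&b_2\end{pmatrix},\qquad K=\det\begin{pmatrix}e_1&f_1\\e_2&f_2\end{pmatrix}$$ (explicitly $J=-\beta x$ and $K=-a\ell$; where $J\ne0$, the Gauss curvature of the surface is $K/J$). For a smooth function $f$ near $t_0$ and an integer $k\ge1$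 write $\operatorname{ord}(f)(t_0)=k$ if $f(t_0)=\dot f(t_0)=\dots=f^{(k-1)}(t_0)=0$ and $f^{(k)}(t_0)\ne0$. For $(i,j)\in\{(2,3),(2,5),(3,4),(3,5)\}$, $\gamma$ has a $j/i$-cusp at $t_0$ if there are $C^\infty$ diffeomorphism germs $\phi:(\mathbb R,t_0)\to(\mathbb R,0)$ and $\Phi:(\mathbb R^2,\gamma(t_0))\to(\mathbb R^2,0)$ such that $\Phi(\gamma(t))=(\phi(t)^i,\phi(t)^j)$ for all $t$ near $t_0$. **Proposition.** Suppose that $\beta$ is real analytic around $t_0$, that $K=cJ$ near $t_0$ for a constant $c\in\mathbb R$, $c\neq0$, that $x(t_0)\ne0$, and that $\operatorname{ord}(a)(t_0)=m+1\le\operatorname{ord}(\beta)(t_0)=n+1$ for some integers $m,n\ge0$. Then $\gamma$ has 1. a $3/2$-cusp at $t_0$ if and only if $\operatorname{ord}(a)(t_0)=\operatorname{ord}(\beta)(t_0)=1$; 2. a $4/3$-cusp at $t_0$ if and only if $\operatorname{ord}(a)(t_0)=\operatorname{ord}(\beta)(t_0)=2$; 3. a $5/3$-cusp at $t_0$ if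 and only if $\operatorname{ord}(a)(t_0)=1$ and $\operatorname{ord}(\beta)(t_0)=2$. Moreover, $\gamma$ does not have a $5/2$-cusp at $t_0$. -/

import Mathlib

open Set Filter Topology
open scoped ContDiff Manifold

namespace RevolutionCusp

noncomputable section

/-! ## Legendre curves in the plane -/

/-- The Euclidean inner product of the plane. -/
def dot (p q : ℝ × ℝ) : ℝ := p.1 * q.1 + p.2 * q.2

/-- The anticlockwise rotation of the plane by the angle `π / 2`. -/
def rot (p : ℝ × ℝ) : ℝ × ℝ := (-p.2, p.1)

/-- `(γ, ν)` is a (smooth) Legendre curve on the open set `I`, with `ν` taking values in the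
unit circle. -/
structure IsLegendreCurve (γ ν : ℝ → ℝ × ℝ) (I : Set ℝ) : Prop where
  smooth_base : ContDiffOn ℝ ∞ γ I
  smooth_normal : ContDiffOn ℝ ∞ ν I
  unit : ∀ t ∈ I, dot (ν t) (ν t) = 1
  legendre : ∀ t ∈ I, dot (deriv γ t) (ν t) = 0

/-- The component `β = γ' · J(ν)` of the curvature `(ℓ, β)` of the Legendre curve `(γ, ν)`. -/
def betaCurv (γ ν : ℝ → ℝ × ℝ) (t : ℝ) : ℝ := dot (deriv γ t) (rot (ν t))

/-! ## Surfaces of revolution as framed surfaces -/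

/-- First-order data of a framed surface `(X, n, s)`: the component along `w` of the partial
derivative of `Y` in the first variable. -/
def compU (Y w : ℝ → ℝ → Fin 3 → ℝ) (u v : ℝ) : ℝ :=
  deriv (fun u' => Y u' v) u ⬝ᵥ w u v

/-- The component along `w` of the partial derivative of `Y` in the second variable. -/
def compV (Y w : ℝ → ℝ → Fin 3 → ℝ) (u v : ℝ) : ℝ :=
  deriv (fun v' => Y u v') v ⬝ᵥ w u v

/-- The third frame vector `n × s`. -/
def thirdFrame (n s : ℝ → ℝ → Fin 3 → ℝ) (u v : ℝ) : Fin 3 → ℝ :=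
  crossProduct (n u v) (s u v)

/-- `J_F = det (a₁ b₁; a₂ b₂)`, where `X_u = a₁ s + b₁ (n × s)` and `X_v = a₂ s + b₂ (n × s)`. -/
def framedJ (X n s : ℝ → ℝ → Fin 3 → ℝ) (u v : ℝ) : ℝ :=
  Matrix.det !![compU X s u v, compU X (thirdFrame n s) u v;
                compV X s u v, compV X (thirdFrame n s) u v]

/-- `K_F = det (e₁ f₁; e₂ f₂)`, where `e₁, f₁` (resp. `e₂, f₂`) are the components of `n_u`
(resp. `n_v`) along `s` and `n × s`. -/
def framedK (n s : ℝ → ℝ → Fin 3 → ℝ) (u v : ℝ) : ℝ :=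
  Matrix.det !![compU n s u v, compU n (thirdFrame n s) u v;
                compV n s u v, compV n (thirdFrame n s) u v]

/-- The surface of revolution of `γ = (x, z)` around the `z`-axis. -/
def revSurface (γ : ℝ → ℝ × ℝ) (t θ : ℝ) : Fin 3 → ℝ :=
  ![(γ t).1 * Real.cos θ, (γ t).1 * Real.sin θ, (γ t).2]

/-- The unit normal of the surface of revolution of a Legendre curve with `ν = (a, b)`. -/
def revNormal (ν : ℝ → ℝ × ℝ) (t θ : ℝ) : Fin 3 → ℝ :=
  ![(ν t).1 * Real.cos θ, (ν t).1 * Real.sin θ, (ν t).2]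

/-- The second frame vector of the surface of revolution. -/
def revTangent (_t θ : ℝ) : Fin 3 → ℝ := ![Real.sin θ, -Real.cos θ, 0]

/-- The function `J` of the surface of revolution of `(γ, ν)` around the `z`-axis. -/
def revJ (γ ν : ℝ → ℝ × ℝ) (t θ : ℝ) : ℝ :=
  framedJ (revSurface γ) (revNormal ν) revTangent t θ

/-- The function `K` of the surface of revolution of `(γ, ν)` around the `z`-axis. -/
def revK (ν : ℝ → ℝ × ℝ) (t θ : ℝ) : ℝ :=
  framedK (revNormal ν) revTangent t θ

/-! ## Order of a zero -/

/-- `ord(f)(t₀) = k`: the derivatives of `f` of order `< k` vanish at `t₀`, the `k`-th one does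
not. -/
def HasOrd (f : ℝ → ℝ) (t₀ : ℝ) (k : ℕ) : Prop :=
  (∀ j < k, iteratedDeriv j f t₀ = 0) ∧ iteratedDeriv k f t₀ ≠ 0

/-! ## `𝒜`-equivalence and cusps -/

/-- The map `φ` represents a smooth diffeomorphism germ `(E, p) → (E, q)`. -/
def IsDiffeoGerm {E : Type*} [NormedAddCommGroup E] [NormedSpace ℝ E]
    (φ : E → E) (p q : E) : Prop :=
  IsLocalDiffeomorphAt 𝓘(ℝ, E) 𝓘(ℝ, E) ∞ φ p ∧ φ p = q

/-- The germ of `f` at `p` (with target point `f p`) is `𝒜`-equivalent to the germ of `g` at `q`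
(with target point `g q`): `Φ ∘ f = g ∘ φ` near `p`, for diffeomorphism germs `φ` of the source
and `Φ` of the target. -/
def AEquivalentAt {E F : Type*} [NormedAddCommGroup E] [NormedSpace ℝ E]
    [NormedAddCommGroup F] [NormedSpace ℝ F] (f : E → F) (p : E) (g : E → F) (q : E) : Prop :=
  ∃ (φ : E → E) (Φ : F → F), IsDiffeoGerm φ p q ∧ IsDiffeoGerm Φ (f p) (g q) ∧
    ∀ᶠ t in 𝓝 p, Φ (f t) = g (φ t)

/-- `γ` has a `j/i`-cusp at `t₀`. -/
def HasCusp (j i : ℕ) (γ : ℝ → ℝ × ℝ) (t₀ : ℝ) : Prop :=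
  AEquivalentAt γ t₀ (fun t : ℝ => (t ^ i, t ^ j)) 0

end

end RevolutionCusp

namespace RevolutionCusp

/-! Write `γ = (x, z)`, `ν = (a, b)`. Since `x' = -bβ` and `z' = aβ`, the equation `K = cJ` becomes
`a a' = -c β x b`, which integrates to `a² = c (x² - x₀²)`. As `b` and `x₀` do not vanish at `t₀`,
the right side has order `ord β + 1`, so `2 ord a = ord β + 1` (`order_eq`) and `ord β` is odd.

The order of `γ - γ(t₀)` is `ord β + 1`, because `z - z₀` vanishes to higher order, and it is
invariant under `𝒜`-equivalence (`HasCusp.eq_order`). Hence `γ` has even order: cusps of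
multiplicity 3 never occur, nor does `ord β = 2`, so the second and third equivalences hold with
both sides false. Multiplicity 2 forces `ord a = ord β = 1`.

Conversely, if `a'(t₀) ≠ 0`, then `a` is a local parameter. Both `x²` and `b²` are affine in `a²`,
so `dz = -a² da / (c x b)` yields `z - z₀ = a³ k(a²)` with `k` smooth and `k 0 ≠ 0`. The coordinates
`s = c (x² - x₀²)` and `(z - z₀) / k(s)` then give `(a², a³)`. The `5/2`-cusp is excluded by
comparing terms of orders 2 and 3 (`not_hasCusp_of_hasLead`). -/

/-- `f` has the leading term `C * (t - t₀) ^ k` at `t₀`. -/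
def HasLead (f : ℝ → ℝ) (t₀ : ℝ) (k : ℕ) (C : ℝ) : Prop :=
  Tendsto (fun t => f t / (t - t₀) ^ k) (𝓝[≠] t₀) (𝓝 C)

theorem _root_.ContDiffAt.deriv_infty {F : Type*} [NormedAddCommGroup F] [NormedSpace ℝ F]
    {f : ℝ → F} {t : ℝ} (hf : ContDiffAt ℝ ∞ f t) : ContDiffAt ℝ ∞ (deriv f) t :=
  (hf.fderiv_right (m := ∞) le_rfl).clm_apply contDiffAt_const

/-! ### Leading terms and orders of vanishing -/

section HasLead

variable {f g : ℝ → ℝ} {t₀ C D : ℝ} {k l : ℕ}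

theorem eventually_sub_ne_zero (t₀ : ℝ) : ∀ᶠ t in 𝓝[≠] t₀, t - t₀ ≠ 0 := by
  filter_upwards [self_mem_nhdsWithin] with t ht
  exact sub_ne_zero.mpr ht

theorem tendsto_sub_nhdsNE (t₀ : ℝ) : Tendsto (fun t => t - t₀) (𝓝[≠] t₀) (𝓝 0) := by
  have : Tendsto (fun t => t - t₀) (𝓝 t₀) (𝓝 (t₀ - t₀)) :=
    (continuous_id.sub continuous_const).tendsto t₀
  rw [sub_self] at this
  exact this.mono_left nhdsWithin_le_nhds

theorem hasLead_zero_of_continuousAt (hf : ContinuousAt f t₀) : HasLead f t₀ 0 (f t₀) := by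
  simpa [HasLead] using hf.tendsto.mono_left nhdsWithin_le_nhds

theorem HasLead.congr (hf : HasLead f t₀ k C) (h : ∀ᶠ t in 𝓝 t₀, f t = g t) :
    HasLead g t₀ k C := by
  refine Tendsto.congr' ?_ hf
  filter_upwards [h.filter_mono nhdsWithin_le_nhds] with t ht
  rw [ht]

theorem HasLead.mul (hf : HasLead f t₀ k C) (hg : HasLead g t₀ l D) :
    HasLead (fun t => f t * g t) t₀ (k + l) (C * D) := by
  refine Tendsto.congr (fun t => ?_) (Tendsto.mul hf hg)
  rw [pow_add, div_mul_div_comm]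

theorem HasLead.pow (hf : HasLead f t₀ k C) (i : ℕ) :
    HasLead (fun t => f t ^ i) t₀ (k * i) (C ^ i) := by
  refine Tendsto.congr (fun t => ?_) (Tendsto.pow hf i)
  rw [div_pow, pow_mul]

theorem HasLead.of_lt (hf : HasLead f t₀ k C) (h : l < k) : HasLead f t₀ l 0 := by
  have h1 := Tendsto.mul hf ((tendsto_sub_nhdsNE t₀).pow (k - l))
  rw [zero_pow (by omega), mul_zero] at h1
  refine Tendsto.congr' ?_ h1
  filter_upwards [eventually_sub_ne_zero t₀] with t ht
  obtain ⟨d, rfl⟩ := Nat.exists_eq_add_of_lt h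
  rw [show l + d + 1 - l = d + 1 by omega, add_assoc, pow_add]
  field_simp

theorem HasLead.unique (hf : HasLead f t₀ k C) (hf' : HasLead f t₀ k D) : C = D :=
  tendsto_nhds_unique hf hf'

/-- `D` may be zero, so a leading term in this sense only bounds the order from below; exactness
comes from `C ≠ 0`. -/
theorem HasLead.le (hf : HasLead f t₀ k C) (hC : C ≠ 0) (hf' : HasLead f t₀ l D) : l ≤ k := by
  by_contra! h
  exact hC (hf.unique (hf'.of_lt h))

theorem HasLead.integrate {f' : ℝ → ℝ} (hd : ∀ᶠ t in 𝓝 t₀, HasDerivAt f (f' t) t)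
    (hf' : HasLead f' t₀ k C) : HasLead (fun t => f t - f t₀) t₀ (k + 1) (C / (k + 1)) := by
  have hk : ((k : ℝ) + 1) ≠ 0 := by positivity
  refine HasDerivAt.lhopital_zero_nhdsNE (f' := f') (g' := fun t => (k + 1) * (t - t₀) ^ k)
    ?_ ?_ ?_ ?_ ?_ ?_
  · filter_upwards [hd.filter_mono nhdsWithin_le_nhds] with t ht
    exact ht.sub_const _
  · refine Eventually.of_forall fun t => ?_
    simpa using ((hasDerivAt_id t).sub_const t₀).fun_pow (k + 1)
  · filter_upwards [eventually_sub_ne_zero t₀] with t ht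
    positivity
  · have := Tendsto.sub_const hd.self_of_nhds.continuousAt.tendsto (f t₀)
    rw [sub_self] at this
    exact this.mono_left nhdsWithin_le_nhds
  · simpa using (tendsto_sub_nhdsNE t₀).pow (k + 1)
  · refine Tendsto.congr (fun t => ?_) (Tendsto.div_const hf' ((k : ℝ) + 1))
    rw [div_div, mul_comm]

theorem hasLead_of_hasDerivAt {f' : ℝ} (hf : HasDerivAt f f' t₀) :
    HasLead (fun t => f t - f t₀) t₀ 1 f' := by
  have := hasDerivAt_iff_tendsto_slope.mp hf
  refine Tendsto.congr (fun t => ?_) this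
  rw [slope_def_field, pow_one]

theorem HasOrd.exists_hasLead (hf : HasOrd f t₀ k) (hs : ContDiffAt ℝ ∞ f t₀) :
    ∃ C, C ≠ 0 ∧ HasLead f t₀ k C := by
  induction k generalizing f with
  | zero =>
    refine ⟨f t₀, by simpa using hf.2, hasLead_zero_of_continuousAt hs.continuousAt⟩
  | succ k ih =>
    have h0 : f t₀ = 0 := by simpa using hf.1 0 (by omega)
    have hs' : ContDiffAt ℝ ∞ (deriv f) t₀ := hs.deriv_infty
    have ho : HasOrd (deriv f) t₀ k := by
      refine ⟨fun j hj => ?_, ?_⟩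
      · rw [← iteratedDeriv_succ']
        exact hf.1 _ (by omega)
      · rw [← iteratedDeriv_succ']
        exact hf.2
    obtain ⟨C, hC, hl⟩ := ih ho hs'
    have hd : ∀ᶠ t in 𝓝 t₀, HasDerivAt f (deriv f t) t := by
      filter_upwards [(hs.of_le (by simp : (1 : WithTop ℕ∞) ≤ ∞)).eventually (by simp)] with t ht
      exact (ht.differentiableAt (by simp)).hasDerivAt
    have := hl.integrate hd
    rw [h0] at this
    exact ⟨C / (k + 1), div_ne_zero hC (by positivity), by simpa using this⟩

theorem HasOrd.unique (hk : HasOrd f t₀ k) (hl : HasOrd f t₀ l) : k = l := by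
  rcases lt_trichotomy k l with h | h | h
  · exact absurd (hl.1 k h) hk.2
  · exact h
  · exact absurd (hk.1 l h) hl.2

end HasLead

/-! ### Diffeomorphism germs and quadratic remainders -/

section Germs

variable {E : Type*} [NormedAddCommGroup E] [NormedSpace ℝ E]

theorem IsDiffeoGerm.contDiffAt {φ : E → E} {p q : E} (h : IsDiffeoGerm φ p q) :
    ContDiffAt ℝ ∞ φ p :=
  contMDiffAt_iff_contDiffAt.mp h.1.contMDiffAt

theorem IsDiffeoGerm.exists_hasFDerivAt {φ : E → E} {p q : E} (h : IsDiffeoGerm φ p q) :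
    ∃ L : E ≃L[ℝ] E, HasFDerivAt φ (L : E →L[ℝ] E) p := by
  let L : E ≃L[ℝ] E := h.1.mfderivToContinuousLinearEquiv (by simp)
  have h1 : (L : E →L[ℝ] E) = fderiv ℝ φ p := by
    rw [← mfderiv_eq_fderiv]
    rfl
  refine ⟨L, ?_⟩
  rw [h1]
  exact (h.contDiffAt.differentiableAt (by simp)).hasFDerivAt

/-- Inverse function theorem. The local inverse is restricted to an open set on which `φ` is smooth
with invertible derivative, so that the inverse is smooth on its whole domain and not only at `q`.
-/
theorem isDiffeoGerm_of_hasFDerivAt [CompleteSpace E] {φ : E → E} {p q : E} (hq : φ p = q)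
    (hφ : ∀ᶠ y in 𝓝 p, ContDiffAt ℝ ∞ φ y) {L : E ≃L[ℝ] E}
    (hL : HasFDerivAt φ (L : E →L[ℝ] E) p) : IsDiffeoGerm φ p q := by
  refine ⟨?_, hq⟩
  have hp : ContDiffAt ℝ ∞ φ p := hφ.self_of_nhds
  have hinv : ∀ᶠ y in 𝓝 p, fderiv ℝ φ y ∈ range ((↑) : (E ≃L[ℝ] E) → E →L[ℝ] E) := by
    have hc : ContinuousAt (fderiv ℝ φ) p := hp.continuousAt_fderiv (by simp)
    refine hc.eventually ?_
    rw [hL.fderiv]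
    exact L.nhds
  obtain ⟨S, hS, hSo, hpS⟩ := eventually_nhds_iff.mp (hφ.and hinv)
  let e := (hp.toOpenPartialHomeomorph φ hL (by simp)).restrOpen S hSo
  have hes : e.source ⊆ S := by
    intro y hy
    simp only [e, OpenPartialHomeomorph.restrOpen_source] at hy
    exact hy.2
  let ψ : PartialDiffeomorph 𝓘(ℝ, E) 𝓘(ℝ, E) E E ∞ :=
    { toPartialEquiv := e.toPartialEquiv
      open_source := e.open_source
      open_target := e.open_target
      contMDiffOn_toFun := by
        refine contMDiffOn_iff_contDiffOn.mpr fun y hy => ?_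
        exact (hS y (hes hy)).1.contDiffWithinAt
      contMDiffOn_invFun := by
        refine contMDiffOn_iff_contDiffOn.mpr fun y hy => ?_
        have hy' : e.symm y ∈ S := hes (e.map_target hy)
        obtain ⟨M, hM⟩ := (hS _ hy').2
        have hd := ((hS _ hy').1.differentiableAt (by simp)).hasFDerivAt
        rw [← hM] at hd
        exact (e.contDiffAt_symm hy hd (hS _ hy').1).contDiffWithinAt }
  refine ⟨ψ, ?_, fun y _ => rfl⟩
  change p ∈ e.source
  simp only [e, OpenPartialHomeomorph.restrOpen_source]
  exact ⟨ContDiffAt.mem_toOpenPartialHomeomorph_source hp hL (by simp), hpS⟩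

variable {F : Type*} [NormedAddCommGroup F] [NormedSpace ℝ F]

/-- Mean value inequality on the ball of radius `‖y - p‖`, where the derivative differs from `L` by
`O(‖y - p‖)`. -/
theorem isBigO_sub_sub_fderiv {f : E → F} {p : E} {L : E →L[ℝ] F}
    (hf : ContDiffAt ℝ 2 f p) (hL : HasFDerivAt f L p) :
    (fun y => f y - f p - L (y - p)) =O[𝓝 p] fun y => ‖y - p‖ ^ 2 := by
  have h1 : ContDiffAt ℝ 1 (fderiv ℝ f) p := hf.fderiv_right (by norm_num)
  have h2 := (h1.differentiableAt (by simp)).hasFDerivAt.isBigO_sub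
  obtain ⟨M, hM⟩ := h2.bound
  have h3 : ∀ᶠ y in 𝓝 p, DifferentiableAt ℝ f y := by
    filter_upwards [hf.eventually (by simp)] with y hy
    exact hy.differentiableAt (by simp)
  obtain ⟨ε, hε, hball⟩ := Metric.eventually_nhds_iff_ball.mp (hM.and h3)
  refine Asymptotics.IsBigO.of_bound |M| ?_
  filter_upwards [Metric.ball_mem_nhds p hε] with y hy
  have hsub : Metric.closedBall p ‖y - p‖ ⊆ Metric.ball p ε := by
    intro w hw
    rw [Metric.mem_closedBall] at hw
    rw [Metric.mem_ball, dist_eq_norm] at hy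
    exact lt_of_le_of_lt hw hy
  have := (convex_closedBall p ‖y - p‖).norm_image_sub_le_of_norm_hasFDerivWithin_le'
    (f := f) (f' := fderiv ℝ f) (φ := L) (C := |M| * ‖y - p‖) (x := p) (y := y)
    (fun w hw => (hball w (hsub hw)).2.hasFDerivAt.hasFDerivWithinAt) ?_
    (by simp) (by simp [dist_eq_norm])
  · refine this.trans (le_of_eq ?_)
    rw [norm_pow, norm_norm]
    ring
  · intro w hw
    have h4 := (hball w (hsub hw)).1
    rw [hL.fderiv] at h4
    rw [Metric.mem_closedBall, dist_eq_norm] at hw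
    refine h4.trans ?_
    gcongr
    exact le_abs_self M

end Germs

/-! ### Primitives of `G(u²) uᵖ` as a power of `u` times a smooth function of `u²` -/

theorem exists_contDiff_eventuallyEq {G : ℝ → ℝ} {s₀ : ℝ}
    (hG : ∀ᶠ s in 𝓝 s₀, ContDiffAt ℝ ∞ G s) :
    ∃ H : ℝ → ℝ, ContDiff ℝ ∞ H ∧ ∀ᶠ s in 𝓝 s₀, H s = G s := by
  obtain ⟨ε, hε, hball⟩ := Metric.eventually_nhds_iff_ball.mp hG
  let χ : ContDiffBump s₀ := ⟨ε / 4, ε / 2, by positivity, by linarith⟩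
  refine ⟨fun s => χ s * G s, contDiff_iff_contDiffAt.mpr fun s => ?_, ?_⟩
  · by_cases hs : s ∈ Metric.ball s₀ ε
    · exact χ.contDiff.contDiffAt.mul (hball s hs)
    · have hs' : s ∉ tsupport χ := by
        rw [χ.tsupport_eq]
        intro h
        refine hs (Metric.closedBall_subset_ball ?_ h)
        change ε / 2 < ε
        linarith
      refine contDiffAt_const (c := (0 : ℝ)) |>.congr_of_eventuallyEq ?_
      filter_upwards [notMem_tsupport_iff_eventuallyEq.mp hs'] with r hr
      simp [hr]
  · filter_upwards [χ.eventuallyEq_one] with s hs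
    simp [hs]

/-- The mean `∫₀¹ G (s r²) r ^ p dr`. -/
noncomputable def sqMean (G : ℝ → ℝ) (p : ℕ) (s : ℝ) : ℝ := ∫ r in (0 : ℝ)..1, G (s * r ^ 2) * r ^ p

theorem continuous_sqMean {G : ℝ → ℝ} (hG : Continuous G) (p : ℕ) : Continuous (sqMean G p) := by
  refine intervalIntegral.continuous_parametric_intervalIntegral_of_continuous' ?_ _ _
  simp only [Function.uncurry_def]
  fun_prop

theorem hasDerivAt_sqMean {G : ℝ → ℝ} (hG : ContDiff ℝ 1 G) (p : ℕ) (s : ℝ) :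
    HasDerivAt (sqMean G p) (sqMean (deriv G) (p + 2) s) s := by
  have hG' : Continuous (deriv G) := hG.continuous_deriv le_rfl
  have hGc : Continuous G := hG.continuous
  obtain ⟨M, hM⟩ := (isCompact_Icc (a := -(|s| + 1)) (b := |s| + 1)).exists_bound_of_continuousOn
    hG'.continuousOn
  have key := intervalIntegral.hasDerivAt_integral_of_dominated_loc_of_deriv_le
    (μ := MeasureTheory.volume) (a := (0 : ℝ)) (b := 1) (x₀ := s) (s := Metric.ball s 1)
    (F := fun s r => G (s * r ^ 2) * r ^ p) (F' := fun s r => deriv G (s * r ^ 2) * r ^ (p + 2))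
    (bound := fun _ => M) (Metric.ball_mem_nhds s one_pos) ?_ ?_ ?_ ?_ ?_ ?_
  · exact key.2
  · exact Eventually.of_forall fun x => Continuous.aestronglyMeasurable (by fun_prop)
  · exact Continuous.intervalIntegrable (by fun_prop) _ _
  · exact Continuous.aestronglyMeasurable (by fun_prop)
  · refine Eventually.of_forall fun r hr x hx => ?_
    rw [uIoc_of_le zero_le_one] at hr
    rw [Metric.mem_ball, Real.dist_eq] at hx
    have hx' : |x| ≤ |s| + 1 := by
      have := abs_sub_abs_le_abs_sub x s
      linarith
    have hr2 : r ^ 2 ≤ 1 := pow_le_one₀ hr.1.le hr.2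
    have hxr : |x * r ^ 2| ≤ |s| + 1 := by
      rw [abs_mul, abs_of_nonneg (sq_nonneg r)]
      exact (mul_le_of_le_one_right (abs_nonneg x) hr2).trans hx'
    have hb := hM (x * r ^ 2) (abs_le.mp hxr)
    rw [norm_mul]
    have hrp : ‖r ^ (p + 2)‖ ≤ 1 := by
      rw [norm_pow, Real.norm_of_nonneg hr.1.le]
      exact pow_le_one₀ hr.1.le hr.2
    exact (mul_le_of_le_one_right (norm_nonneg _) hrp).trans hb
  · exact continuous_const.intervalIntegrable _ _
  · refine Eventually.of_forall fun r _ x _ => ?_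
    have h1 : HasDerivAt G (deriv G (x * r ^ 2)) (x * r ^ 2) :=
      (hG.differentiable one_ne_zero _).hasDerivAt
    have h2 := (h1.comp x ((hasDerivAt_id x).mul_const (r ^ 2))).mul_const (r ^ p)
    refine h2.congr_deriv ?_
    ring

/-- Differentiating under the integral replaces `(G, p)` by `(G', p + 2)`, so the induction must run
over all `G` and `p`. -/
theorem contDiff_sqMean {G : ℝ → ℝ} (hG : ContDiff ℝ ∞ G) (p : ℕ) :
    ContDiff ℝ ∞ (sqMean G p) := by
  refine contDiff_infty.mpr fun N => ?_
  induction N generalizing G p with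
  | zero => exact contDiff_zero.mpr (continuous_sqMean hG.continuous p)
  | succ N ih =>
    have hd := hasDerivAt_sqMean (hG.of_le (by simp)) p
    rw [Nat.cast_add, Nat.cast_one, contDiff_succ_iff_deriv]
    refine ⟨fun s => (hd s).differentiableAt, by simp, ?_⟩
    rw [show deriv (sqMean G p) = sqMean (deriv G) (p + 2) from funext fun s => (hd s).deriv]
    exact ih (contDiff_infty_iff_deriv.mp hG).2 (p + 2)

theorem sqMean_zero (G : ℝ → ℝ) (p : ℕ) : sqMean G p 0 = G 0 / (p + 1) := by
  simp [sqMean, integral_pow]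
  ring

theorem pow_mul_sqMean_sq (G : ℝ → ℝ) (p : ℕ) (u : ℝ) :
    u ^ (p + 1) * sqMean G p (u ^ 2) = ∫ v in (0 : ℝ)..u, G (v ^ 2) * v ^ p := by
  have h := intervalIntegral.smul_integral_comp_mul_left (a := 0) (b := 1)
    (fun v => G (v ^ 2) * v ^ p) u
  rw [mul_zero, mul_one] at h
  rw [← h, smul_eq_mul, pow_succ', mul_assoc, sqMean, ← intervalIntegral.integral_const_mul]
  congr 2
  ext r
  rw [mul_pow, mul_pow]
  ring

theorem hasDerivAt_pow_mul_sqMean_sq {G : ℝ → ℝ} (hG : Continuous G) (p : ℕ) (u : ℝ) :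
    HasDerivAt (fun u => u ^ (p + 1) * sqMean G p (u ^ 2)) (G (u ^ 2) * u ^ p) u := by
  simp only [pow_mul_sqMean_sq]
  have hc : Continuous fun v : ℝ => G (v ^ 2) * v ^ p := by fun_prop
  exact intervalIntegral.integral_hasDerivAt_right (hc.intervalIntegrable _ _)
    (hc.stronglyMeasurableAtFilter _ _) hc.continuousAt

theorem eventuallyEq_of_hasDerivAt {f g f' : ℝ → ℝ} {t₀ : ℝ}
    (hf : ∀ᶠ t in 𝓝 t₀, HasDerivAt f (f' t) t) (hg : ∀ᶠ t in 𝓝 t₀, HasDerivAt g (f' t) t)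
    (h0 : f t₀ = g t₀) : ∀ᶠ t in 𝓝 t₀, f t = g t := by
  obtain ⟨ε, hε, hball⟩ := Metric.eventually_nhds_iff_ball.mp (hf.and hg)
  filter_upwards [Metric.ball_mem_nhds t₀ hε] with t ht
  have hd : ∀ s ∈ Metric.ball t₀ ε, HasDerivAt (fun s => f s - g s) 0 s := fun s hs => by
    simpa using (hball s hs).1.fun_sub (hball s hs).2
  have := Metric.isOpen_ball.is_const_of_deriv_eq_zero (convex_ball t₀ ε).isPreconnected
    (fun s hs => (hd s hs).differentiableAt.differentiableWithinAt)
    (fun s hs => (hd s hs).deriv) ht (Metric.mem_ball_self hε)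
  simp only [h0, sub_self] at this
  linarith

/-! ### The functions `J` and `K` on the meridian `θ = 0` -/

section Frame

theorem hasDerivAt_vec3 {f g h : ℝ → ℝ} {f' g' h' t : ℝ} (hf : HasDerivAt f f' t)
    (hg : HasDerivAt g g' t) (hh : HasDerivAt h h' t) :
    HasDerivAt (fun t => (![f t, g t, h t] : Fin 3 → ℝ)) ![f', g', h'] t := by
  rw [hasDerivAt_pi]
  intro i
  fin_cases i <;> simpa

theorem deriv_revSurface_left {γ : ℝ → ℝ × ℝ} {t x' z' : ℝ}
    (hx : HasDerivAt (fun t => (γ t).1) x' t) (hz : HasDerivAt (fun t => (γ t).2) z' t) :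
    deriv (fun t => revSurface γ t 0) t = ![x', 0, z'] := by
  have := hasDerivAt_vec3 (hx.mul_const (Real.cos 0)) (hx.mul_const (Real.sin 0)) hz
  simpa [revSurface] using this.deriv

theorem deriv_revSurface_right (γ : ℝ → ℝ × ℝ) (t : ℝ) :
    deriv (fun θ => revSurface γ t θ) 0 = ![0, (γ t).1, 0] := by
  have := hasDerivAt_vec3 ((Real.hasDerivAt_cos 0).const_mul (γ t).1)
    ((Real.hasDerivAt_sin 0).const_mul (γ t).1) (hasDerivAt_const (0 : ℝ) (γ t).2)
  simpa [revSurface] using this.deriv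

theorem thirdFrame_rev_zero (ν : ℝ → ℝ × ℝ) (t : ℝ) :
    thirdFrame (revNormal ν) revTangent t 0 = ![(ν t).2, 0, -(ν t).1] := by
  simp [thirdFrame, revNormal, revTangent, crossProduct]

theorem revJ_zero {γ ν : ℝ → ℝ × ℝ} {t x' z' : ℝ} (hx : HasDerivAt (fun t => (γ t).1) x' t)
    (hz : HasDerivAt (fun t => (γ t).2) z' t) :
    revJ γ ν t 0 = (x' * (ν t).2 - z' * (ν t).1) * (γ t).1 := by
  rw [revJ, framedJ, Matrix.det_fin_two_of]
  simp only [compU, compV, thirdFrame_rev_zero, deriv_revSurface_left hx hz,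
    deriv_revSurface_right]
  simp [revTangent, Matrix.vecHead, Matrix.vecTail]
  left
  ring

/-- `revNormal ν` is by definition the surface of revolution of `ν`, so the computation of `J`
applies with `γ` replaced by `ν`. -/
theorem revK_zero {ν : ℝ → ℝ × ℝ} {t a' b' : ℝ} (ha : HasDerivAt (fun t => (ν t).1) a' t)
    (hb : HasDerivAt (fun t => (ν t).2) b' t) :
    revK ν t 0 = (a' * (ν t).2 - b' * (ν t).1) * (ν t).1 :=
  revJ_zero ha hb

end Frame

/-! ### The differential equations of the profile -/

/-- The components of a Legendre curve `(γ, ν)` near `t₀` with `ν.1 = a` vanishing at `t₀`, whose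
surface of revolution satisfies `K = c J`. -/
structure ConstantCurvatureProfile (x z a b β : ℝ → ℝ) (t₀ c : ℝ) : Prop where
  deriv_x : ∀ᶠ t in 𝓝 t₀, HasDerivAt x (-(b t * β t)) t
  deriv_z : ∀ᶠ t in 𝓝 t₀, HasDerivAt z (a t * β t) t
  smooth_a : ∀ᶠ t in 𝓝 t₀, ContDiffAt ℝ ∞ a t
  continuous_b : ContinuousAt b t₀
  smooth_beta : ContDiffAt ℝ ∞ β t₀
  unit : ∀ᶠ t in 𝓝 t₀, a t ^ 2 + b t ^ 2 = 1
  curvature : ∀ᶠ t in 𝓝 t₀, a t * deriv a t = -(c * β t * x t * b t)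
  a_zero : a t₀ = 0
  c_ne : c ≠ 0
  x_ne : x t₀ ≠ 0

theorem IsLegendreCurve.profile {I : Set ℝ} (hI : IsOpen I) {t₀ : ℝ} (ht₀ : t₀ ∈ I)
    {γ ν : ℝ → ℝ × ℝ} (hγν : IsLegendreCurve γ ν I) {c : ℝ} (hc : c ≠ 0)
    (hKJ : ∀ᶠ t in 𝓝 t₀, ∀ θ ∈ Ico 0 (2 * Real.pi), revK ν t θ = c * revJ γ ν t θ)
    (hx : (γ t₀).1 ≠ 0) (ha : (ν t₀).1 = 0) :
    ConstantCurvatureProfile (fun t => (γ t).1) (fun t => (γ t).2) (fun t => (ν t).1)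
      (fun t => (ν t).2) (betaCurv γ ν) t₀ c := by
  have hIe : ∀ᶠ t in 𝓝 t₀, t ∈ I := hI.mem_nhds ht₀
  have sγ : ∀ t ∈ I, ContDiffAt ℝ ∞ γ t := fun t ht =>
    hγν.smooth_base.contDiffAt (hI.mem_nhds ht)
  have sν : ∀ t ∈ I, ContDiffAt ℝ ∞ ν t := fun t ht =>
    hγν.smooth_normal.contDiffAt (hI.mem_nhds ht)
  have hd : ∀ f : ℝ → ℝ × ℝ, ∀ t, ContDiffAt ℝ ∞ f t →
      HasDerivAt (fun t => (f t).1) (deriv f t).1 t ∧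
      HasDerivAt (fun t => (f t).2) (deriv f t).2 t := fun f t hf => by
    have h := (hf.differentiableAt (by simp)).hasDerivAt
    exact ⟨h.fst, h.snd⟩
  have hu : ∀ t ∈ I, (ν t).1 ^ 2 + (ν t).2 ^ 2 = 1 := fun t ht => by
    have := hγν.unit t ht
    simp only [dot] at this
    linarith
  have hx' : ∀ t ∈ I, (deriv γ t).1 = -((ν t).2 * betaCurv γ ν t) := fun t ht => by
    have h1 := hγν.legendre t ht
    have h2 := hu t ht
    simp only [dot, betaCurv, rot] at h1 ⊢
    linear_combination (ν t).1 * h1 - (deriv γ t).1 * h2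
  have hz' : ∀ t ∈ I, (deriv γ t).2 = (ν t).1 * betaCurv γ ν t := fun t ht => by
    have h1 := hγν.legendre t ht
    have h2 := hu t ht
    simp only [dot, betaCurv, rot] at h1 ⊢
    linear_combination (ν t).2 * h1 - (deriv γ t).2 * h2
  refine ⟨?_, ?_, ?_, ?_, ?_, ?_, ?_, ha, hc, hx⟩
  · filter_upwards [hIe] with t ht
    exact hx' t ht ▸ (hd γ t (sγ t ht)).1
  · filter_upwards [hIe] with t ht
    exact hz' t ht ▸ (hd γ t (sγ t ht)).2
  · filter_upwards [hIe] with t ht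
    exact (sν t ht).fst
  · exact (sν t₀ ht₀).continuousAt.snd
  · have h1 := (sγ t₀ ht₀).deriv_infty
    have h2 := sν t₀ ht₀
    change ContDiffAt ℝ ∞ (fun t => (deriv γ t).1 * -(ν t).2 + (deriv γ t).2 * (ν t).1) t₀
    exact (h1.fst.mul h2.snd.neg).add (h1.snd.mul h2.fst)
  · filter_upwards [hIe] with t ht
    exact hu t ht
  · filter_upwards [hIe, hKJ] with t ht hk
    have hk0 := hk 0 ⟨le_rfl, by positivity⟩
    obtain ⟨h1, h2⟩ := hd γ t (sγ t ht)
    obtain ⟨h3, h4⟩ := hd ν t (sν t ht)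
    rw [revJ_zero h1 h2, revK_zero h3 h4, hx' t ht, hz' t ht] at hk0
    rw [h3.deriv]
    have h5 := hu t ht
    have h6 : (ν t).1 * (deriv ν t).1 + (ν t).2 * (deriv ν t).2 = 0 := by
      have h7 : HasDerivAt (fun t => (ν t).1 ^ 2 + (ν t).2 ^ 2) _ t :=
        (h3.fun_pow 2).fun_add (h4.fun_pow 2)
      have h8 : HasDerivAt (fun t => (ν t).1 ^ 2 + (ν t).2 ^ 2) 0 t := by
        refine (hasDerivAt_const t (1 : ℝ)).congr_of_eventuallyEq ?_
        filter_upwards [hI.mem_nhds ht] with s hs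
        exact hu s hs
      have h9 := h7.unique h8
      norm_num at h9
      linarith
    generalize betaCurv γ ν t = B at *
    -- Multiply `K = cJ` by `b` and eliminate `b b'` by `a a' + b b' = 0`.
    linear_combination (ν t).2 * hk0 + (ν t).1 ^ 2 * h6 - (ν t).1 * (deriv ν t).1 * h5
      - c * B * (γ t).1 * (ν t).2 * h5

/-! ### Invariants of cusps -/

theorem IsDiffeoGerm.exists_hasLead {φ : ℝ → ℝ} {t₀ : ℝ} (h : IsDiffeoGerm φ t₀ 0) :
    ∃ α, α ≠ 0 ∧ HasLead φ t₀ 1 α := by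
  obtain ⟨L, hL⟩ := h.exists_hasFDerivAt
  refine ⟨L 1, by simp, ?_⟩
  have := hasLead_of_hasDerivAt hL.hasDerivAt
  simpa [h.2] using this

theorem HasLead.hasFDerivAt_comp {E : Type*} [NormedAddCommGroup E] [NormedSpace ℝ E]
    {γ : ℝ → ℝ × ℝ} {t₀ C D : ℝ} {k : ℕ} {Φ : ℝ × ℝ → E} {L : ℝ × ℝ →L[ℝ] E}
    (hL : HasFDerivAt Φ L (γ t₀)) (hγ : ContinuousAt γ t₀)
    (hx : HasLead (fun t => (γ t).1 - (γ t₀).1) t₀ k C)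
    (hz : HasLead (fun t => (γ t).2 - (γ t₀).2) t₀ k D) :
    Tendsto (fun t => ((t - t₀) ^ k)⁻¹ • (Φ (γ t) - Φ (γ t₀))) (𝓝[≠] t₀) (𝓝 (L (C, D))) := by
  have hd : Tendsto (fun t => γ t - γ t₀) (𝓝[≠] t₀) (𝓝 0) := by
    have := Tendsto.sub_const hγ.tendsto (γ t₀)
    rw [sub_self] at this
    exact this.mono_left nhdsWithin_le_nhds
  have hv : Tendsto (fun t => ((t - t₀) ^ k)⁻¹ • (γ t - γ t₀)) (𝓝[≠] t₀) (𝓝 (C, D)) := by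
    refine Tendsto.congr (fun t => ?_) (Tendsto.prodMk_nhds hx hz)
    ext <;> simp [div_eq_inv_mul]
  simpa using (hasFDerivWithinAt_univ.mpr hL).lim hd (Eventually.of_forall fun _ => mem_univ _) hv

/-- The invertible derivative of `Φ` sends the leading vector `(C, 0)` of `γ` to a nonzero leading
vector of `Φ ∘ γ` at the same order `k`, whereas `(φ ^ i, φ ^ j)` has order exactly `i`. -/
theorem HasCusp.eq_order {γ : ℝ → ℝ × ℝ} {t₀ C : ℝ} {i j k : ℕ} (h : HasCusp j i γ t₀)
    (hij : i < j) (hi : i ≠ 0) (hγ : ContinuousAt γ t₀) (hC : C ≠ 0)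
    (hx : HasLead (fun t => (γ t).1 - (γ t₀).1) t₀ k C)
    (hz : HasLead (fun t => (γ t).2 - (γ t₀).2) t₀ k 0) : i = k := by
  obtain ⟨φ, Φ, hφ, hΦ, he⟩ := h
  obtain ⟨α, hα, hφα⟩ := hφ.exists_hasLead
  obtain ⟨L, hL⟩ := hΦ.exists_hasFDerivAt
  have hlim := hx.hasFDerivAt_comp hL hγ hz
  have hL0 : L (C, 0) ≠ 0 := by simpa using hC
  have hj : j ≠ 0 := by omega
  have hΦ0 : Φ (γ t₀) = 0 := by simpa [hi, hj, Prod.zero_eq_mk] using hΦ.2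
  have h1 : HasLead (fun t => φ t ^ i) t₀ k (L (C, 0)).1 := by
    refine Tendsto.congr' ?_ ((continuous_fst.tendsto _).comp hlim)
    filter_upwards [he.filter_mono nhdsWithin_le_nhds] with t ht
    simp [ht, hΦ0, div_eq_inv_mul]
  have h2 : HasLead (fun t => φ t ^ j) t₀ k (L (C, 0)).2 := by
    refine Tendsto.congr' ?_ ((continuous_snd.tendsto _).comp hlim)
    filter_upwards [he.filter_mono nhdsWithin_le_nhds] with t ht
    simp [ht, hΦ0, div_eq_inv_mul]
  have hi' := hφα.pow i
  have hj' := hφα.pow j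
  rw [one_mul] at hi' hj'
  have hki := hi'.le (pow_ne_zero _ hα) h1
  refine le_antisymm ?_ hki
  have h20 : (L (C, 0)).2 = 0 := h2.unique (hj'.of_lt (hki.trans_lt hij))
  refine h1.le (fun h10 => hL0 (Prod.ext h10 h20)) hi'

/-- The second component of `Φ ∘ γ` would vanish to order `j > 3`. Its order 2 and order 3 terms are
`∂ₓΦ₂ · C` and `∂_zΦ₂ · D`, so the differential of `Φ₂` would be zero, contradicting invertibility.
-/
theorem not_hasCusp_of_hasLead {γ : ℝ → ℝ × ℝ} {t₀ C D : ℝ} {j : ℕ} (hj : 3 < j)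
    (hγ : ContinuousAt γ t₀) (hC : C ≠ 0) (hD : D ≠ 0)
    (hx : HasLead (fun t => (γ t).1 - (γ t₀).1) t₀ 2 C)
    (hz : HasLead (fun t => (γ t).2 - (γ t₀).2) t₀ 3 D) : ¬ HasCusp j 2 γ t₀ := by
  rintro ⟨φ, Φ, hφ, hΦ, he⟩
  obtain ⟨α, hα, hφα⟩ := hφ.exists_hasLead
  obtain ⟨L, hL⟩ := hΦ.exists_hasFDerivAt
  have hz2 : HasLead (fun t => (γ t).2 - (γ t₀).2) t₀ 2 0 := hz.of_lt (by omega)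
  have hj0 : j ≠ 0 := by omega
  have hΦ0 : Φ (γ t₀) = 0 := by simpa [hj0, Prod.zero_eq_mk] using hΦ.2
  have hφj := hφα.pow j
  rw [one_mul] at hφj
  have hL2 : HasFDerivAt (fun p => (Φ p).2) ((ContinuousLinearMap.snd ℝ ℝ ℝ).comp
      (L : ℝ × ℝ →L[ℝ] ℝ × ℝ)) (γ t₀) := hL.snd
  have hp : (L (1, 0)).2 = 0 := by
    have h1 : HasLead (fun t => φ t ^ j) t₀ 2 (L (C, 0)).2 := by
      refine Tendsto.congr' ?_ (hx.hasFDerivAt_comp hL2 hγ hz2)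
      filter_upwards [he.filter_mono nhdsWithin_le_nhds] with t ht
      simp [ht, hΦ0, div_eq_inv_mul]
    have h2 : (L (C, 0)).2 = 0 := h1.unique (hφj.of_lt (by omega))
    have h3 : ((C, 0) : ℝ × ℝ) = C • (1, 0) := by simp
    rw [h3, map_smul, Prod.smul_snd, smul_eq_mul] at h2
    exact (mul_eq_zero.mp h2).resolve_left hC
  -- The nonlinear part of `Φ₂` is `O(‖γ - γ t₀‖²)`, of order 4, and cannot affect the cubic term.
  have hq : (L (0, 1)).2 = 0 := by
    have hO := (isBigO_sub_sub_fderiv (contDiffAt_infty.mp hΦ.contDiffAt.snd 2) hL2).comp_tendsto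
      (hγ.tendsto.mono_left (nhdsWithin_le_nhds (s := {t₀}ᶜ)))
    have hsq : Tendsto (fun t => ‖γ t - γ t₀‖ ^ 2 / (t - t₀) ^ 3) (𝓝[≠] t₀) (𝓝 0) := by
      have hv := hx.hasFDerivAt_comp (hasFDerivAt_id (γ t₀)) hγ hz2
      have h1 := (hv.norm.pow 2).mul (tendsto_sub_nhdsNE t₀)
      rw [mul_zero] at h1
      refine Tendsto.congr' ?_ h1
      filter_upwards [eventually_sub_ne_zero t₀] with t ht
      rw [norm_smul, mul_pow, norm_inv, norm_pow, inv_pow, Real.norm_eq_abs, ← pow_mul, mul_comm 2 2,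
        pow_mul, sq_abs]
      simp only [id]
      field_simp
    have hR : Tendsto (fun t => ((Φ (γ t)).2 - (Φ (γ t₀)).2 - (L (γ t - γ t₀)).2) / (t - t₀) ^ 3)
        (𝓝[≠] t₀) (𝓝 0) := by
      have h1 := hO.mul (Asymptotics.isBigO_refl (fun t => ((t - t₀) ^ 3)⁻¹) (𝓝[≠] t₀))
      exact h1.trans_tendsto hsq
    have h2 : Tendsto (fun t => ((Φ (γ t)).2 - (Φ (γ t₀)).2 - (L (γ t - γ t₀)).2) / (t - t₀) ^ 3)
        (𝓝[≠] t₀) (𝓝 (0 - (L (0, 1)).2 * D)) := by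
      refine Tendsto.congr' ?_ (Tendsto.sub (hφj.of_lt hj) (Tendsto.const_mul (L (0, 1)).2 hz))
      filter_upwards [he.filter_mono nhdsWithin_le_nhds] with t ht
      have h3 : γ t - γ t₀ = ((γ t).1 - (γ t₀).1) • ((1, 0) : ℝ × ℝ)
          + ((γ t).2 - (γ t₀).2) • ((0, 1) : ℝ × ℝ) := by
        ext <;> simp
      rw [ht, hΦ0, h3, map_add, map_smul, map_smul]
      simp only [Prod.snd_add, Prod.smul_snd, smul_eq_mul, hp, Prod.snd_zero]
      ring
    have h4 := tendsto_nhds_unique hR h2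
    rw [zero_sub, eq_comm, neg_eq_zero] at h4
    exact (mul_eq_zero.mp h4).resolve_right hD
  obtain ⟨v, hv⟩ := L.surjective (0, 1)
  have h3 : v = v.1 • ((1, 0) : ℝ × ℝ) + v.2 • ((0, 1) : ℝ × ℝ) := by
    ext <;> simp
  rw [h3, map_add, map_smul, map_smul] at hv
  have := congrArg Prod.snd hv
  simp [hp, hq] at this

/-! ### The first integral and the parity of the order -/

namespace ConstantCurvatureProfile

variable {x z a b β : ℝ → ℝ} {t₀ c : ℝ}

theorem b_ne (h : ConstantCurvatureProfile x z a b β t₀ c) : b t₀ ≠ 0 := by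
  intro hb
  have := h.unit.self_of_nhds
  simp [h.a_zero, hb] at this

theorem continuous_x (h : ConstantCurvatureProfile x z a b β t₀ c) : ContinuousAt x t₀ :=
  h.deriv_x.self_of_nhds.continuousAt

theorem first_integral (h : ConstantCurvatureProfile x z a b β t₀ c) :
    ∀ᶠ t in 𝓝 t₀, a t ^ 2 = c * (x t ^ 2 - x t₀ ^ 2) := by
  refine eventuallyEq_of_hasDerivAt (f' := fun t => -(2 * c * β t * x t * b t)) ?_ ?_ ?_
  · filter_upwards [h.smooth_a, h.curvature] with t ha hk
    have := ((ha.differentiableAt (by simp)).hasDerivAt).fun_pow 2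
    refine this.congr_deriv ?_
    norm_num
    linarith
  · filter_upwards [h.deriv_x] with t hx
    refine (((hx.fun_pow 2).sub_const (x t₀ ^ 2)).const_mul c).congr_deriv ?_
    norm_num
    ring
  · simp [h.a_zero]

variable {m n : ℕ} {A B : ℝ}

theorem hasLead_x (h : ConstantCurvatureProfile x z a b β t₀ c) (hβ : HasLead β t₀ n B) :
    HasLead (fun t => x t - x t₀) t₀ (n + 1) (-b t₀ * B / (n + 1)) := by
  have h1 := (hasLead_zero_of_continuousAt (f := fun t => -b t) h.continuous_b.neg).mul hβ
  rw [zero_add] at h1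
  refine HasLead.integrate (f' := fun t => -b t * β t) ?_ h1
  filter_upwards [h.deriv_x] with t ht
  simpa using ht

theorem hasLead_z (h : ConstantCurvatureProfile x z a b β t₀ c) (ha : HasLead a t₀ m A)
    (hβ : HasLead β t₀ n B) :
    HasLead (fun t => z t - z t₀) t₀ (m + n + 1) (A * B / (m + n + 1)) := by
  simpa using (ha.mul hβ).integrate h.deriv_z

/-- Compare orders in `a² = (x - x₀) · c (x + x₀)`, whose last factor is nonzero at `t₀`. -/
theorem order_eq (h : ConstantCurvatureProfile x z a b β t₀ c) (hA : A ≠ 0)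
    (ha : HasLead a t₀ m A) (hB : B ≠ 0) (hβ : HasLead β t₀ n B) : n + 1 = 2 * m := by
  have h1 := (h.hasLead_x hβ).mul (hasLead_zero_of_continuousAt
    (f := fun t => c * (x t + x t₀)) ((h.continuous_x.add_const (x t₀)).const_mul c))
  have h2 := (ha.pow 2).congr (g := fun t => (x t - x t₀) * (c * (x t + x t₀))) (by
    filter_upwards [h.first_integral] with t ht
    rw [ht]
    ring)
  have hne : -b t₀ * B / (n + 1) * (c * (x t₀ + x t₀)) ≠ 0 := by
    have := h.b_ne
    have := h.c_ne
    have := h.x_ne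
    rw [← two_mul]
    have : (n : ℝ) + 1 ≠ 0 := by positivity
    simp_all
  have h3 := h1.le hne h2
  have h4 := h2.le (pow_ne_zero 2 hA) h1
  omega

end ConstantCurvatureProfile

/-! ### The `3/2` normal form -/

namespace ConstantCurvatureProfile

variable {x z a b β : ℝ → ℝ} {t₀ c : ℝ}

/-- The factor `-1 / (c x b)` in `dz` is a smooth function of `a²`. It is extended to all of `ℝ` so
that `sqMean` applies. -/
theorem exists_xb_eq (h : ConstantCurvatureProfile x z a b β t₀ c) :
    ∃ H : ℝ → ℝ, ContDiff ℝ ∞ H ∧ H 0 ≠ 0 ∧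
      ∀ᶠ t in 𝓝 t₀, H (a t ^ 2) * (c * x t * b t) = -1 := by
  have hx := h.x_ne
  have hb := h.b_ne
  have hc := h.c_ne
  have ha : ContinuousAt (fun t => a t ^ 2) t₀ := h.smooth_a.self_of_nhds.continuousAt.pow 2
  -- `P(a²) = (x b / (x₀ b₀))²`, by the first integral, `b² = 1 - a²` and `b₀² = 1`; continuity at
  -- `t₀` fixes the sign of the root.
  let P : ℝ → ℝ := fun s => (1 + s / (c * x t₀ ^ 2)) * (1 - s)
  have hP : ContDiff ℝ ∞ P := by fun_prop
  have hPpos : ∀ᶠ s in 𝓝 (0 : ℝ), 0 < P s :=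
    hP.continuous.continuousAt.eventually (lt_mem_nhds (by simp [P]))
  obtain ⟨H, hH, hHe⟩ := exists_contDiff_eventuallyEq (s₀ := (0 : ℝ))
    (G := fun s => -(c * (x t₀ * b t₀) * √(P s))⁻¹) (by
      filter_upwards [hPpos] with s hs
      refine ContDiffAt.neg (ContDiffAt.inv (contDiffAt_const.mul (hP.contDiffAt.sqrt hs.ne')) ?_)
      have := (Real.sqrt_pos.mpr hs).ne'
      positivity)
  refine ⟨H, hH, ?_, ?_⟩
  · rw [hHe.self_of_nhds]
    simp [P, hx, hb, hc]
  · have hta : Tendsto (fun t => a t ^ 2) (𝓝 t₀) (𝓝 0) := by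
      simpa [ContinuousAt, h.a_zero] using ha
    have hpos : ∀ᶠ t in 𝓝 t₀, 0 < x t * b t / (x t₀ * b t₀) := by
      refine ((h.continuous_x.mul h.continuous_b).div_const _).eventually (lt_mem_nhds ?_)
      simp [hx, hb]
    filter_upwards [hta.eventually hHe, hta.eventually hPpos, hpos, h.unit, h.first_integral]
      with t h1 h2 h3 h4 h5
    have hb2 : b t₀ ^ 2 = 1 := by simpa [h.a_zero] using h.unit.self_of_nhds
    have hsq : √(P (a t ^ 2)) = x t * b t / (x t₀ * b t₀) := by
      have hP2 : P (a t ^ 2) = (x t * b t / (x t₀ * b t₀)) ^ 2 := by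
        rw [div_pow, mul_pow, mul_pow, hb2, show b t ^ 2 = 1 - a t ^ 2 by linarith]
        simp only [P]
        nth_rewrite 1 [h5]
        field_simp
        ring
      rw [hP2, Real.sqrt_sq h3.le]
    have hxb : x t * b t ≠ 0 := by
      intro h0
      simp [h0] at h3
    rw [h1, hsq]
    have hxt := left_ne_zero_of_mul hxb
    have hbt := right_ne_zero_of_mul hxb
    field_simp

/-- Both sides have derivative `aβ`: the primitive of `H(u²) u²` is `u³` times `sqMean H 2` at `u²`,
and `H(a²) a² a' = aβ`. -/
theorem exists_z_eq (h : ConstantCurvatureProfile x z a b β t₀ c) :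
    ∃ k : ℝ → ℝ, ContDiff ℝ ∞ k ∧ k 0 ≠ 0 ∧
      ∀ᶠ t in 𝓝 t₀, z t - z t₀ = a t ^ 3 * k (a t ^ 2) := by
  obtain ⟨H, hH, hH0, hHe⟩ := h.exists_xb_eq
  refine ⟨sqMean H 2, contDiff_sqMean hH 2, ?_, ?_⟩
  · rw [sqMean_zero]
    positivity
  · refine eventuallyEq_of_hasDerivAt (f' := fun t => a t * β t) ?_ ?_ ?_
    · filter_upwards [h.deriv_z] with t ht
      exact ht.sub_const _
    · filter_upwards [h.smooth_a, h.curvature, hHe] with t h1 h2 h3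
      have h4 := (hasDerivAt_pow_mul_sqMean_sq hH.continuous 2 (a t)).comp t
        (h1.differentiableAt (by simp)).hasDerivAt
      refine h4.congr_deriv ?_
      linear_combination H (a t ^ 2) * a t * h2 - a t * β t * h3
    · simp [h.a_zero]

end ConstantCurvatureProfile

theorem hasCusp_of_profile {γ : ℝ → ℝ × ℝ} {a b β : ℝ → ℝ} {t₀ c : ℝ}
    (h : ConstantCurvatureProfile (fun t => (γ t).1) (fun t => (γ t).2) a b β t₀ c)
    (ha : deriv a t₀ ≠ 0) : HasCusp 3 2 γ t₀ := by
  obtain ⟨k, hk, hk0, hkz⟩ := h.exists_z_eq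
  set x₀ := (γ t₀).1 with hx₀
  set z₀ := (γ t₀).2 with hz₀
  have hx0 : x₀ ≠ 0 := h.x_ne
  have hc := h.c_ne
  let s : ℝ × ℝ → ℝ := fun p => c * (p.1 ^ 2 - x₀ ^ 2)
  have hs : ContDiff ℝ ∞ s := by fun_prop
  have hs0 : s (γ t₀) = 0 := by simp [s, hx₀]
  let Φ : ℝ × ℝ → ℝ × ℝ := fun p => (s p, (p.2 - z₀) / k (s p))
  have hks : ∀ᶠ p in 𝓝 (γ t₀), k (s p) ≠ 0 := by
    refine (hk.continuous.comp hs.continuous).continuousAt.eventually_ne ?_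
    simpa [hs0] using hk0
  refine ⟨a, Φ, ?_, ?_, ?_⟩
  · refine isDiffeoGerm_of_hasFDerivAt h.a_zero h.smooth_a
      (L := ContinuousLinearEquiv.unitsEquivAut ℝ (Units.mk0 _ ha)) ?_
    have := (h.smooth_a.self_of_nhds.differentiableAt (by simp)).hasDerivAt.hasFDerivAt
    refine this.congr_fderiv ?_
    ext
    simp
  · let e₁ := ContinuousLinearEquiv.unitsEquivAut ℝ
      (Units.mk0 (c * (2 * x₀)) (by positivity))
    let e₂ := ContinuousLinearEquiv.unitsEquivAut ℝ (Units.mk0 (k 0)⁻¹ (by positivity))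
    refine isDiffeoGerm_of_hasFDerivAt (L := e₁.prodCongr e₂) ?_ ?_ ?_
    · simp [Φ, hs0, hz₀]
    · filter_upwards [hks] with p hp
      refine hs.contDiffAt.prodMk (ContDiffAt.div (by fun_prop) ?_ hp)
      exact (hk.comp hs).contDiffAt
    · have h1 : HasFDerivAt (fun p : ℝ × ℝ => p.1) (ContinuousLinearMap.fst ℝ ℝ ℝ) (γ t₀) :=
        hasFDerivAt_fst
      have h2 : HasFDerivAt (fun p : ℝ × ℝ => p.2 - z₀) (ContinuousLinearMap.snd ℝ ℝ ℝ) (γ t₀) :=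
        hasFDerivAt_snd.sub_const _
      have hds : HasFDerivAt s ((c * (2 * x₀)) • ContinuousLinearMap.fst ℝ ℝ ℝ) (γ t₀) := by
        have h3 : HasDerivAt (fun u : ℝ => c * (u ^ 2 - x₀ ^ 2)) (c * (2 * x₀)) x₀ := by
          simpa using ((hasDerivAt_pow 2 x₀).sub_const (x₀ ^ 2)).const_mul c
        exact HasDerivAt.comp_hasFDerivAt (f := fun p : ℝ × ℝ => p.1) (γ t₀) h3 h1
      have hki : DifferentiableAt ℝ (fun p => (k (s p))⁻¹) (γ t₀) :=
        ((hk.comp hs).differentiable (by simp) _).inv hks.self_of_nhds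
      have hd2 := h2.mul hki.hasFDerivAt
      refine (hds.prodMk hd2).congr_fderiv ?_
      ext
      · simp [e₁]
      · simp [e₁, ← hz₀]
      · simp [e₁]
      · simp [e₂, hs0, ← hz₀]
  · filter_upwards [hkz, h.first_integral, h.smooth_a.self_of_nhds.continuousAt.eventually
      ((hk.continuous.comp (continuous_pow 2)).continuousAt.eventually_ne
        (by simpa [h.a_zero] using hk0))] with t h1 h2 h3
    have h4 : s (γ t) = a t ^ 2 := h2.symm
    have h5 : k (a t ^ 2) ≠ 0 := h3
    simp only [Φ, h4, h1, mul_div_assoc, div_self h5, mul_one]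

end RevolutionCusp

/-! ### The classification -/

theorem mainTheorem4 (I : Set ℝ) (hI : IsOpen I) (hI_conn : I.OrdConnected)
    (t₀ : ℝ) (ht₀ : t₀ ∈ I) (γ ν : ℝ → ℝ × ℝ) (hγν : RevolutionCusp.IsLegendreCurve γ ν I)
    (hβ : AnalyticAt ℝ (RevolutionCusp.betaCurv γ ν) t₀)
    (c : ℝ) (hc : c ≠ 0)
    (hKJ : ∀ᶠ t in 𝓝 t₀, ∀ θ ∈ Ico 0 (2 * Real.pi),
      RevolutionCusp.revK ν t θ = c * RevolutionCusp.revJ γ ν t θ)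
    (hx : (γ t₀).1 ≠ 0)
    (m n : ℕ) (hmn : m + 1 ≤ n + 1)
    (hm : RevolutionCusp.HasOrd (fun t => (ν t).1) t₀ (m + 1))
    (hn : RevolutionCusp.HasOrd (RevolutionCusp.betaCurv γ ν) t₀ (n + 1)) :
    (RevolutionCusp.HasCusp 3 2 γ t₀ ↔
      RevolutionCusp.HasOrd (fun t => (ν t).1) t₀ 1 ∧
        RevolutionCusp.HasOrd (RevolutionCusp.betaCurv γ ν) t₀ 1) ∧
    (RevolutionCusp.HasCusp 4 3 γ t₀ ↔
      RevolutionCusp.HasOrd (fun t => (ν t).1) t₀ 2 ∧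
        RevolutionCusp.HasOrd (RevolutionCusp.betaCurv γ ν) t₀ 2) ∧
    (RevolutionCusp.HasCusp 5 3 γ t₀ ↔
      RevolutionCusp.HasOrd (fun t => (ν t).1) t₀ 1 ∧
        RevolutionCusp.HasOrd (RevolutionCusp.betaCurv γ ν) t₀ 2) ∧
    ¬ RevolutionCusp.HasCusp 5 2 γ t₀ := by
  have ha0 : (ν t₀).1 = 0 := by simpa using hm.1 0 (by omega)
  have h := hγν.profile hI ht₀ hc hKJ hx ha0
  have hγ : ContinuousAt γ t₀ :=
    (hγν.smooth_base.contDiffAt (hI.mem_nhds ht₀)).continuousAt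
  obtain ⟨A, hA, hlA⟩ := hm.exists_hasLead h.smooth_a.self_of_nhds
  obtain ⟨B, hB, hlB⟩ := hn.exists_hasLead h.smooth_beta
  have hnm := h.order_eq hA hlA hB hlB
  have hlx := h.hasLead_x hlB
  have hlz := h.hasLead_z hlA hlB
  have hC : -(ν t₀).2 * B / (((n + 1 : ℕ) : ℝ) + 1) ≠ 0 :=
    div_ne_zero (mul_ne_zero (neg_ne_zero.mpr h.b_ne) hB) (by positivity)
  -- The multiplicity of any cusp is `n + 2`, and `hnm` makes this number even.
  have hcusp : ∀ i j : ℕ, i < j → i ≠ 0 → RevolutionCusp.HasCusp j i γ t₀ → i = n + 2 :=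
    fun i j hij hi hcu => hcu.eq_order hij hi hγ hC hlx (hlz.of_lt (by omega))
  refine ⟨⟨fun hcu => ?_, fun ho => ?_⟩, ⟨fun hcu => ?_, fun ho => ?_⟩,
    ⟨fun hcu => ?_, fun ho => ?_⟩, fun hcu => ?_⟩
  · have := hcusp 2 3 (by omega) (by omega) hcu
    obtain rfl : n = 0 := by omega
    obtain rfl : m = 0 := by omega
    exact ⟨hm, hn⟩
  · refine RevolutionCusp.hasCusp_of_profile h ?_
    simpa using ho.1.2
  · have := hcusp 3 4 (by omega) (by omega) hcu
    -- Multiplicity 3 contradicts parity; likewise `ord β = 2` in the converse, and again for the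
    -- `5/3`-cusp.
    omega
  · have := hn.unique ho.2
    omega
  · have := hcusp 3 5 (by omega) (by omega) hcu
    omega
  · have := hn.unique ho.2
    omega
  · have := hcusp 2 5 (by omega) (by omega) hcu
    obtain rfl : n = 0 := by omega
    obtain rfl : m = 0 := by omega
    refine RevolutionCusp.not_hasCusp_of_hasLead (by omega) hγ hC ?_ hlx hlz hcu
    exact div_ne_zero (mul_ne_zero hA hB) (by positivity)
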